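/- Consider a multi-armed bandit with $A$ arms. A bandit instance $\underline\nu=(\nu_a)_{a=1}^A$ assigns to each arm $a$ a reward distribution $\nu_a$ on $[0,1]$ with mean $r(a)$. In each round $t=1,2,\dots$ a (randomized) strategy $\pi$ chooses an arm $a_t$ and a query indicator $q_t\in\{0,1\}$ as measurable functions of the past information $I_{t-1}=(U_0,Y_1,U_1,\dots,Y_{t-1},U_{t-1})$, where $U_0,U_1,\dots$ are i.i.d. uniform on $[0,1]$ (internal randomization). Given $I_{t-1}$, a reward $R_t$ with distribution $\nu_{a_t}$ is generated, independently of $U_t$, and only $Y_t=R_tq_t$ is observed. The pseudo-regret is $\mathrm{Reg}(T)=\sum_{t=1}^T\bigl(\max_a r(a)-r(a_t)\bigr)$, and, given querying costs $c(1),\dots,c(A)$, the cost of the queries in the first $t$ rounds is $B^q(t)=\sum_{k=1}^t c(a_k)\mathbf 1\{q_k=1\}$. Let $T\ge 1$ and $A\ge 2$ be integers, let $c(1),\dots,c(A)\ge 0$ be querying costs, and let $0<B(1)\le B(2)\le\dots\le B(T)$ be an arbitrary non-decreasing budget sequence. Let $\pi$ be a strategy such that $\mathbb E_{\underline\nu}[B^q(t)]\le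 B(t)$ for every bandit instance $\underline\nu$ and every $t\in\{1,\dots,T\}$. Then there exists a bandit instance $\underline\nu$ for which $$\mathbb E_{\underline\nu}[\mathrm{Reg}(T)]\ \ge\ \frac{1}{140(1+\log T)}\sum_{t=1}^T\min\left\{\sqrt{\frac{\sum_{a=1}^A c(a)}{B(t)(1+\log A)}},\,1\right\}.$$ -/

import Mathlib

open MeasureTheory ProbabilityTheory

noncomputable section

namespace BudgetedBandit

/-- A bandit instance with `A` arms: one reward distribution on `[0,1]` for each arm. -/
abbrev Instance (A : ℕ) : Type := Fin A → ProbabilityMeasure unitInterval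

/-- The mean reward `r(a)` of arm `a`. -/
def meanReward {A : ℕ} (ν : Instance A) (a : Fin A) : ℝ :=
  ∫ x : unitInterval, (x : ℝ) ∂(ν a : Measure unitInterval)

/-- The information `I_t = (U_0, Y_1, U_1, …, Y_t, U_t)` available after `t` rounds: the `i`-th
entry is the pair `(Y_i, U_i)` of the observation made in round `i` and the internal randomization
drawn at the end of round `i`. No observation is made at time `0`: there the law of the
interaction puts the constant `Y_0 = 0`. -/
abbrev Info (t : ℕ) : Type := (i : Finset.Iic t) → (fun _ : ℕ => unitInterval × unitInterval) i

/-- A (randomized) strategy: measurable maps `π_t^a`, `π_t^q` that choose the arm `a_{t+1}`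
and decide whether its reward is queried (`q_{t+1} = 1`) from the information `I_t`. -/
structure Strategy (A : ℕ) where
  arm : (t : ℕ) → Info t → Fin A
  query : (t : ℕ) → Info t → Bool
  measurable_arm : ∀ t, Measurable (arm t)
  measurable_query : ∀ t, Measurable (query t)

/-- The law of the observation `Y = R * q` when `R` has law `ν_a`. -/
def obsLaw {A : ℕ} (ν : Instance A) (a : Fin A) (q : Bool) : Measure unitInterval :=
  (ν a : Measure unitInterval).map (fun r => if q then r else 0)

instance {A : ℕ} (ν : Instance A) (a : Fin A) (q : Bool) :
    IsProbabilityMeasure (obsLaw ν a q) := by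
  unfold obsLaw
  refine Measure.isProbabilityMeasure_map (Measurable.aemeasurable ?_)
  cases q
  · simp
  · simpa using measurable_id'

/-- `obsLaw` as a Markov kernel. -/
def obsKernel {A : ℕ} (ν : Instance A) : Kernel (Fin A × Bool) unitInterval :=
  Kernel.ofFunOfCountable (fun p => obsLaw ν p.1 p.2)

instance {A : ℕ} (ν : Instance A) : IsMarkovKernel (obsKernel ν) :=
  ⟨fun p => inferInstanceAs (IsProbabilityMeasure (obsLaw ν p.1 p.2))⟩

/-- The conditional law of `(Y_{t+1}, U_{t+1})` given `I_t`: the observation has law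
`obsLaw ν a_{t+1} q_{t+1}`, and `U_{t+1}` is uniform on `[0,1]` and independent of it. -/
def stepKernel {A : ℕ} (π : Strategy A) (ν : Instance A) (t : ℕ) :
    Kernel (Info t) (unitInterval × unitInterval) :=
  (Kernel.comap (obsKernel ν) (fun h => (π.arm t h, π.query t h))
      ((π.measurable_arm t).prodMk (π.measurable_query t))) ×ₖ
    (Kernel.const (Info t) (volume : Measure unitInterval))

instance {A : ℕ} (π : Strategy A) (ν : Instance A) (t : ℕ) :
    IsMarkovKernel (stepKernel π ν t) := by
  unfold stepKernel
  infer_instance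

/-- An infinite sequence `(Y_0, U_0), (Y_1, U_1), …` of observations and randomizations. -/
abbrev Path : Type := (n : ℕ) → (fun _ : ℕ => unitInterval × unitInterval) n

/-- The law of the interaction of the strategy `π` with the instance `ν`: `Y_0 = 0`, `U_0` is
uniform on `[0,1]`, and `(Y_{t+1}, U_{t+1})` given the past is drawn from `stepKernel π ν t`. -/
def law {A : ℕ} (π : Strategy A) (ν : Instance A) : Measure Path :=
  Kernel.trajMeasure (X := fun _ : ℕ => unitInterval × unitInterval)
    ((Measure.dirac (0 : unitInterval)).prod (volume : Measure unitInterval)) (stepKernel π ν)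

/-- The information `I_t` contained in a path. -/
def info (t : ℕ) (ω : Path) : Info t := Preorder.frestrictLe t ω

/-- The cost `B^q(t) = ∑_{k=1}^t c(a_k) 1{q_k = 1}` of the queries made in the first `t` rounds;
the round `k = s + 1` is played on the information `I_s`. -/
def queryCost {A : ℕ} (π : Strategy A) (c : Fin A → ℝ) (t : ℕ) (ω : Path) : ℝ :=
  ∑ s ∈ Finset.range t, if π.query s (info s ω) = true then c (π.arm s (info s ω)) else 0

/-- The pseudo-regret `Reg(T) = ∑_{k=1}^T (max_a r(a) - r(a_k))`. -/
def regret {A : ℕ} (π : Strategy A) (ν : Instance A) (T : ℕ) (ω : Path) : ℝ :=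
  ∑ s ∈ Finset.range T, ((⨆ a, meanReward ν a) - meanReward ν (π.arm s (info s ω)))

end BudgetedBandit

end

namespace BudgetedBandit

/-! A bandit whose arms are all fair coins is compared with one in which a single arm has its mean
shifted by `ε / 10`. Let `C` be the total cost and let `t` be a round at which `t * min (√(C / B t))
1` is maximal; `ε` is that minimum. On the fair instance the budget forces some arm `a` to have an
expected number of queries `n` up to round `t` with `n * ε ^ 2 ≤ 1` (`exists_instance_of_budget`):
otherwise the expected query cost would exceed `B t`.

Only queries of `a` can reveal the shift, and each contributes at most `ε ^ 2 / 48` to the KL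
divergence. Hence expectations of `[0,1]`-valued functions of the past drop by at most `3 / 10`
(`integral_baseInstance_sub_altInstance_le`, `sum_integral_altInstance_ge`). If `a` is played in at
most half of the first `t` rounds, raising its mean makes neglecting it costly; otherwise lowering
its mean makes playing it costly. Either way the regret is at least `t * ε / 50`
(`exists_instance_of_few_queries`).

Finally, a sum of terms `f t` with `t * f t ≤ M` is at most `M * (1 + log T)`, which turns the bound
at the best `t` into a bound by the whole sum. The factor `1 + log A` only weakens the claim. -/

/-! ### Bernoulli instances -/

/-- The Bernoulli reward distribution with mean `p`. -/
noncomputable def bernoulliReward (p : unitInterval) : ProbabilityMeasure unitInterval :=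
  ⟨ENNReal.ofReal p • Measure.dirac 1 + ENNReal.ofReal (1 - p) • Measure.dirac 0, ⟨by
    have h0 := p.2.1
    have h1 := p.2.2
    simp only [Measure.coe_add, Measure.coe_smul, Pi.add_apply, Pi.smul_apply, measure_univ,
      smul_eq_mul, mul_one]
    rw [← ENNReal.ofReal_add h0 (by linarith)]
    simp⟩⟩

lemma lintegral_bernoulliReward (p : unitInterval) (f : unitInterval → ENNReal) :
    ∫⁻ x, f x ∂(bernoulliReward p : Measure unitInterval)
      = ENNReal.ofReal p * f 1 + ENNReal.ofReal (1 - p) * f 0 := by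
  simp [bernoulliReward]

lemma integral_bernoulliReward (p : unitInterval) (f : unitInterval → ℝ) :
    ∫ x, f x ∂(bernoulliReward p : Measure unitInterval) = p * f 1 + (1 - p) * f 0 := by
  have h0 := p.2.1
  have h1 := p.2.2
  have hi : ∀ x : unitInterval, ∀ r : ℝ,
      Integrable f (ENNReal.ofReal r • Measure.dirac x) := fun x r =>
    (integrable_dirac (by simp)).smul_measure ENNReal.ofReal_ne_top
  simp only [bernoulliReward, ProbabilityMeasure.coe_mk]
  rw [integral_add_measure (hi _ _) (hi _ _), integral_smul_measure, integral_smul_measure]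
  simp [ENNReal.toReal_ofReal h0, ENNReal.toReal_ofReal (sub_nonneg.2 h1)]

/-- The instance whose arm `a` has Bernoulli rewards with mean `m a`. -/
noncomputable def bernoulliInstance {A : ℕ} (m : Fin A → unitInterval) : Instance A :=
  fun a => bernoulliReward (m a)

@[simp]
lemma meanReward_bernoulliInstance {A : ℕ} (m : Fin A → unitInterval) (a : Fin A) :
    meanReward (bernoulliInstance m) a = m a := by
  simp [meanReward, bernoulliInstance, integral_bernoulliReward]

lemma obsLaw_true {A : ℕ} (ν : Instance A) (a : Fin A) :
    obsLaw ν a true = (ν a : Measure unitInterval) := by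
  simp [obsLaw]

lemma obsLaw_false {A : ℕ} (ν : Instance A) (a : Fin A) :
    obsLaw ν a false = Measure.dirac 0 := by
  simp [obsLaw, Measure.map_const]

lemma stepKernel_apply {A : ℕ} (π : Strategy A) (ν : Instance A) (t : ℕ) (h : Info t) :
    stepKernel π ν t h = (obsLaw ν (π.arm t h) (π.query t h)).prod volume := by
  rw [stepKernel, Kernel.prod_apply, Kernel.comap_apply, Kernel.const_apply]
  rfl

instance {A : ℕ} (π : Strategy A) (ν : Instance A) : IsProbabilityMeasure (law π ν) := by
  unfold law
  infer_instance

lemma measurable_info (t : ℕ) : Measurable (info t) :=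
  Preorder.measurable_frestrictLe t

/-! ### Disintegration of the law along the last round -/

/-- The information available one round later. -/
def Info.extend {t : ℕ} (p : Info t × (unitInterval × unitInterval)) : Info (t + 1) :=
  fun i => if h : (i : ℕ) ≤ t then p.1 ⟨i, Finset.mem_Iic.2 h⟩ else p.2

/-- The information available one round earlier. -/
def Info.prev {t : ℕ} (h : Info (t + 1)) : Info t :=
  fun i => h ⟨i, Finset.mem_Iic.2 ((Finset.mem_Iic.1 i.2).trans t.le_succ)⟩

/-- The last entry of the information. -/
def Info.last {t : ℕ} (h : Info t) : unitInterval × unitInterval :=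
  h ⟨t, Finset.mem_Iic.2 le_rfl⟩

lemma Info.measurable_extend {t : ℕ} : Measurable (Info.extend (t := t)) := by
  refine measurable_pi_lambda _ fun i => ?_
  by_cases h : (i : ℕ) ≤ t
  · simpa [Info.extend, h] using measurable_fst.eval
  · simpa [Info.extend, h] using measurable_snd

lemma Info.measurable_prev {t : ℕ} : Measurable (Info.prev (t := t)) :=
  measurable_pi_lambda _ fun _ => measurable_pi_apply _

lemma Info.measurable_last {t : ℕ} : Measurable (Info.last (t := t)) :=
  measurable_pi_apply _

@[simp]
lemma Info.prev_info {t : ℕ} (ω : Path) : Info.prev (info (t + 1) ω) = info t ω := rfl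

@[simp]
lemma Info.last_info {t : ℕ} (ω : Path) : Info.last (info t ω) = ω t := rfl

lemma Info.extend_info (t : ℕ) (ω : Path) :
    Info.extend (info t ω, ω (t + 1)) = info (t + 1) ω := by
  funext i
  by_cases h : (i : ℕ) ≤ t
  · simp only [Info.extend, h, dif_pos]; rfl
  · have hi : (i : ℕ) = t + 1 := by
      have := Finset.mem_Iic.1 i.2
      omega
    obtain ⟨i, hi'⟩ := i
    obtain rfl : i = t + 1 := hi
    simp only [Info.extend, h]; rfl

lemma map_law_succ {A : ℕ} (π : Strategy A) (ν : Instance A) (t : ℕ) :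
    (law π ν).map (fun ω => (info t ω, ω (t + 1)))
      = (law π ν).map (info t) ⊗ₘ stepKernel π ν t :=
  (Kernel.map_frestrictLe_trajMeasure_compProd_eq_map_trajMeasure
    (X := fun _ : ℕ => unitInterval × unitInterval)).symm

lemma lintegral_law_succ {A : ℕ} (π : Strategy A) (ν : Instance A) (t : ℕ)
    {F : Info t × (unitInterval × unitInterval) → ENNReal} (hF : Measurable F) :
    ∫⁻ ω, F (info t ω, ω (t + 1)) ∂(law π ν)
      = ∫⁻ ω, ∫⁻ y, F (info t ω, y) ∂(stepKernel π ν t (info t ω)) ∂(law π ν) := by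
  have hm : Measurable fun ω : Path => (info t ω, ω (t + 1)) :=
    (measurable_info t).prodMk (measurable_pi_apply _)
  rw [← lintegral_map hF hm, map_law_succ, Measure.lintegral_compProd hF,
    lintegral_map hF.lintegral_kernel_prod_right' (measurable_info t)]

lemma integral_law_succ {A : ℕ} (π : Strategy A) (ν : Instance A) (t : ℕ)
    {F : Info t × (unitInterval × unitInterval) → ℝ} (hF : Measurable F)
    {K : ℝ} (hK : ∀ p, |F p| ≤ K) :
    ∫ ω, F (info t ω, ω (t + 1)) ∂(law π ν)
      = ∫ ω, ∫ y, F (info t ω, y) ∂(stepKernel π ν t (info t ω)) ∂(law π ν) := by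
  have hm : Measurable fun ω : Path => (info t ω, ω (t + 1)) :=
    (measurable_info t).prodMk (measurable_pi_apply _)
  have : IsProbabilityMeasure ((law π ν).map (info t)) :=
    Measure.isProbabilityMeasure_map (measurable_info t).aemeasurable
  have hi : Integrable F ((law π ν).map (info t) ⊗ₘ stepKernel π ν t) :=
    Integrable.of_bound hF.aestronglyMeasurable K (ae_of_all _ hK)
  rw [← integral_map hm.aemeasurable hF.aestronglyMeasurable, map_law_succ,
    Measure.integral_compProd hi, integral_map (measurable_info t).aemeasurable]
  exact hF.stronglyMeasurable.integral_kernel_prod_right'.aestronglyMeasurable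

/-! ### Likelihood ratios and change of measure -/

/-- The instance with fair Bernoulli rewards for every arm. -/
noncomputable def baseInstance (A : ℕ) : Instance A :=
  bernoulliInstance fun _ => ⟨1 / 2, by norm_num, by norm_num⟩

/-- The base instance with the mean of arm `a` changed to `p`. -/
noncomputable def altInstance {A : ℕ} (a : Fin A) (p : unitInterval) : Instance A :=
  bernoulliInstance (Function.update (fun _ => ⟨1 / 2, by norm_num, by norm_num⟩) a p)

/-- The likelihood ratio of `altInstance a p` to `baseInstance` in one round. -/
noncomputable def stepLikelihood {A : ℕ} (π : Strategy A) (a : Fin A) (p : unitInterval) (t : ℕ)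
    (x : Info t × (unitInterval × unitInterval)) : ℝ :=
  if π.arm t x.1 = a ∧ π.query t x.1 = true then
    1 + (2 * (p : ℝ) - 1) * (2 * (x.2.1 : ℝ) - 1) else 1

lemma measurableSet_query {A : ℕ} (π : Strategy A) (a : Fin A) (t : ℕ) :
    MeasurableSet {h : Info t | π.arm t h = a ∧ π.query t h = true} :=
  (π.measurable_arm t (measurableSet_singleton a)).inter
    (π.measurable_query t (measurableSet_singleton true))

lemma measurable_stepLikelihood {A : ℕ} (π : Strategy A) (a : Fin A) (p : unitInterval) (t : ℕ) :
    Measurable (stepLikelihood π a p t) :=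
  Measurable.ite (measurable_fst (measurableSet_query π a t)) (by fun_prop) measurable_const

/-- The ratio is affine in the observation, with values `2 * p` at `1` and `2 * (1 - p)` at `0`. It
is therefore bounded at every point of `[0,1]`, and no almost-everywhere argument is needed later.
-/
lemma stepLikelihood_mem {A : ℕ} (π : Strategy A) (a : Fin A) (p : unitInterval) (t : ℕ)
    (x : Info t × (unitInterval × unitInterval)) :
    stepLikelihood π a p t x ∈ Set.Icc (1 - |2 * (p : ℝ) - 1|) 2 := by
  have h0 := p.2.1
  have h1 := p.2.2
  have hp : |2 * (p : ℝ) - 1| ≤ 1 := abs_le.2 ⟨by linarith, by linarith⟩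
  have hy : |2 * (x.2.1 : ℝ) - 1| ≤ 1 :=
    abs_le.2 ⟨by linarith [x.2.1.2.1], by linarith [x.2.1.2.2]⟩
  have hm : |(2 * (p : ℝ) - 1) * (2 * (x.2.1 : ℝ) - 1)| ≤ |2 * (p : ℝ) - 1| := by
    rw [abs_mul]
    exact mul_le_of_le_one_right (abs_nonneg _) hy
  have := abs_le.1 hm
  unfold stepLikelihood
  split_ifs
  · exact ⟨by linarith, by linarith⟩
  · exact ⟨by linarith [abs_nonneg (2 * (p : ℝ) - 1)], by norm_num⟩

lemma one_sub_abs_pos {p : unitInterval} (h0 : 0 < (p : ℝ)) (h1 : (p : ℝ) < 1) :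
    0 < 1 - |2 * (p : ℝ) - 1| := by
  have : |2 * (p : ℝ) - 1| < 1 := abs_lt.2 ⟨by linarith, by linarith⟩
  linarith

lemma stepLikelihood_pos {A : ℕ} (π : Strategy A) (a : Fin A) {p : unitInterval}
    (h0 : 0 < (p : ℝ)) (h1 : (p : ℝ) < 1) (t : ℕ)
    (x : Info t × (unitInterval × unitInterval)) : 0 < stepLikelihood π a p t x :=
  (one_sub_abs_pos h0 h1).trans_le (stepLikelihood_mem π a p t x).1

/-- The two kernels differ only when `a` is queried: without a query the observation is `0` under
both, and the other arms have the same reward law. -/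
lemma lintegral_stepKernel_altInstance {A : ℕ} (π : Strategy A) (a : Fin A) (p : unitInterval)
    (t : ℕ) (h : Info t) {F : unitInterval × unitInterval → ENNReal} (hF : Measurable F) :
    ∫⁻ y, F y ∂(stepKernel π (altInstance a p) t h)
      = ∫⁻ y, F y * ENNReal.ofReal (stepLikelihood π a p t (h, y))
          ∂(stepKernel π (baseInstance A) t h) := by
  have hp := p.2.1
  have hp' := p.2.2
  have hL : Measurable fun y => ENNReal.ofReal (stepLikelihood π a p t (h, y)) :=
    ((measurable_stepLikelihood π a p t).comp measurable_prodMk_left).ennreal_ofReal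
  have hFL : Measurable fun y => F y * ENNReal.ofReal (stepLikelihood π a p t (h, y)) := hF.mul hL
  rw [stepKernel_apply, stepKernel_apply, lintegral_prod _ hF.aemeasurable,
    lintegral_prod _ hFL.aemeasurable]
  by_cases hq : π.arm t h = a ∧ π.query t h = true
  · rw [hq.1, hq.2, obsLaw_true, obsLaw_true]
    simp only [stepLikelihood, if_pos hq, altInstance, baseInstance, bernoulliInstance,
      lintegral_bernoulliReward, Function.update_self]
    have hFy : ∀ y, Measurable fun u => F (y, u) := fun y => hF.comp measurable_prodMk_left
    rw [lintegral_mul_const _ (hFy 1), lintegral_mul_const _ (hFy 0)]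
    have e1 : ENNReal.ofReal (p : ℝ) = ENNReal.ofReal (1 / 2) *
        ENNReal.ofReal (1 + (2 * (p : ℝ) - 1) * (2 * ((1 : unitInterval) : ℝ) - 1)) := by
      rw [← ENNReal.ofReal_mul (by norm_num)]
      congr 1
      simp
      ring
    have e0 : ENNReal.ofReal (1 - (p : ℝ)) = ENNReal.ofReal (1 - 1 / 2) *
        ENNReal.ofReal (1 + (2 * (p : ℝ) - 1) * (2 * ((0 : unitInterval) : ℝ) - 1)) := by
      rw [← ENNReal.ofReal_mul (by norm_num)]
      congr 1
      simp
      ring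
    rw [e1, e0]
    ring
  · simp only [stepLikelihood, if_neg hq, ENNReal.ofReal_one, mul_one]
    cases hqb : π.query t h
    · rw [obsLaw_false, obsLaw_false]
    · have ha : π.arm t h ≠ a := fun ha => hq ⟨ha, hqb⟩
      rw [obsLaw_true, obsLaw_true]
      simp only [altInstance, baseInstance, bernoulliInstance, Function.update_of_ne ha]

/-- The likelihood ratio of `altInstance a p` to `baseInstance` after `t` rounds. -/
noncomputable def likelihood {A : ℕ} (π : Strategy A) (a : Fin A) (p : unitInterval) :
    (t : ℕ) → Info t → ℝ
  | 0, _ => 1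
  | t + 1, h => likelihood π a p t (Info.prev h) * stepLikelihood π a p t (Info.prev h, Info.last h)

lemma measurable_likelihood {A : ℕ} (π : Strategy A) (a : Fin A) (p : unitInterval) (t : ℕ) :
    Measurable (likelihood π a p t) := by
  induction t with
  | zero => exact measurable_const
  | succ t ih =>
    exact (ih.comp Info.measurable_prev).mul ((measurable_stepLikelihood π a p t).comp
      (Info.measurable_prev.prodMk Info.measurable_last))

lemma likelihood_pos {A : ℕ} (π : Strategy A) (a : Fin A) {p : unitInterval}
    (h0 : 0 < (p : ℝ)) (h1 : (p : ℝ) < 1) (t : ℕ) (h : Info t) : 0 < likelihood π a p t h := by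
  induction t with
  | zero => exact one_pos
  | succ t ih => exact mul_pos (ih _) (stepLikelihood_pos π a h0 h1 t _)

lemma likelihood_le {A : ℕ} (π : Strategy A) (a : Fin A) {p : unitInterval}
    (h0 : 0 < (p : ℝ)) (h1 : (p : ℝ) < 1) (t : ℕ) (h : Info t) :
    likelihood π a p t h ≤ 2 ^ t := by
  induction t with
  | zero => simp [likelihood]
  | succ t ih =>
    rw [pow_succ]
    exact mul_le_mul (ih _) (stepLikelihood_mem π a p t _).2
      (stepLikelihood_pos π a h0 h1 t _).le (by positivity)

lemma lintegral_law_altInstance {A : ℕ} (π : Strategy A) (a : Fin A) {p : unitInterval}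
    (h0 : 0 < (p : ℝ)) (h1 : (p : ℝ) < 1) (t : ℕ) {g : Info t → ENNReal} (hg : Measurable g) :
    ∫⁻ ω, g (info t ω) ∂(law π (altInstance a p))
      = ∫⁻ ω, g (info t ω) * ENNReal.ofReal (likelihood π a p t (info t ω))
          ∂(law π (baseInstance A)) := by
  induction t with
  | zero =>
    -- Before any reward is observed, the law of the information does not depend on the instance.
    have h : ∀ ν : Instance A, (law π ν).map (info 0) =
        ((Measure.dirac (0 : unitInterval)).prod (volume : Measure unitInterval)).map
          (MeasurableEquiv.piUnique (fun _ : Finset.Iic 0 => unitInterval × unitInterval)).symm := by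
      intro ν
      change (law π ν).map (Preorder.frestrictLe 0) = _
      rw [law, Kernel.trajMeasure, Measure.map_comp _ _ (by fun_prop),
        Kernel.traj_map_frestrictLe, Kernel.partialTraj_self, Measure.id_comp]
    simp only [likelihood, ENNReal.ofReal_one, mul_one]
    rw [← lintegral_map hg (measurable_info 0), ← lintegral_map hg (measurable_info 0), h, h]
  | succ t ih =>
    have hG : Measurable fun x : Info t × (unitInterval × unitInterval) => g (Info.extend x) :=
      hg.comp Info.measurable_extend
    have hL := (measurable_stepLikelihood π a p t).ennreal_ofReal
    have hΛ := (measurable_likelihood π a p t).ennreal_ofReal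
    have hGL : Measurable fun x : Info t × (unitInterval × unitInterval) =>
        g (Info.extend x) * ENNReal.ofReal (stepLikelihood π a p t x) := hG.mul hL
    have hGLΛ : Measurable fun x : Info t × (unitInterval × unitInterval) =>
        g (Info.extend x) * ENNReal.ofReal (stepLikelihood π a p t x)
          * ENNReal.ofReal (likelihood π a p t x.1) := hGL.mul (hΛ.comp measurable_fst)
    have e1 : ∀ ω, g (info (t + 1) ω)
        = (fun x : Info t × (unitInterval × unitInterval) => g (Info.extend x))
            (info t ω, ω (t + 1)) := fun ω => by
      simp only [Info.extend_info]
    have e2 : ∀ ω, g (info (t + 1) ω) * ENNReal.ofReal (likelihood π a p (t + 1) (info (t + 1) ω))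
        = (fun x : Info t × (unitInterval × unitInterval) =>
            g (Info.extend x) * ENNReal.ofReal (stepLikelihood π a p t x)
              * ENNReal.ofReal (likelihood π a p t x.1)) (info t ω, ω (t + 1)) := fun ω => by
      simp only [Info.extend_info, likelihood, Info.prev_info, Info.last_info]
      rw [ENNReal.ofReal_mul (likelihood_pos π a h0 h1 t _).le]
      ring
    simp_rw [e2]
    simp_rw [e1]
    rw [lintegral_law_succ π _ t hG, lintegral_law_succ π _ t hGLΛ]
    have e3 : ∀ h, ∫⁻ y, g (Info.extend (h, y)) ∂(stepKernel π (altInstance a p) t h)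
        = ∫⁻ y, g (Info.extend (h, y)) * ENNReal.ofReal (stepLikelihood π a p t (h, y))
          ∂(stepKernel π (baseInstance A) t h) := fun h =>
      lintegral_stepKernel_altInstance π a p t h (hG.comp measurable_prodMk_left)
    simp_rw [e3]
    rw [ih (g := fun h => ∫⁻ y, g (Info.extend (h, y)) *
        ENNReal.ofReal (stepLikelihood π a p t (h, y)) ∂(stepKernel π (baseInstance A) t h))
      hGL.lintegral_kernel_prod_right']
    refine lintegral_congr fun ω => ?_
    have hGLω : Measurable fun y => g (Info.extend (info t ω, y)) *
        ENNReal.ofReal (stepLikelihood π a p t (info t ω, y)) := hGL.comp measurable_prodMk_left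
    rw [lintegral_mul_const _ hGLω]

lemma integral_law_altInstance {A : ℕ} (π : Strategy A) (a : Fin A) {p : unitInterval}
    (h0 : 0 < (p : ℝ)) (h1 : (p : ℝ) < 1) (t : ℕ) {g : Info t → ℝ} (hg : Measurable g)
    (hg0 : ∀ h, 0 ≤ g h) :
    ∫ ω, g (info t ω) ∂(law π (altInstance a p))
      = ∫ ω, g (info t ω) * likelihood π a p t (info t ω) ∂(law π (baseInstance A)) := by
  have hm := hg.comp (measurable_info t)
  have hΛ := (measurable_likelihood π a p t).comp (measurable_info t)
  rw [integral_eq_lintegral_of_nonneg_ae (ae_of_all _ fun ω => hg0 _) hm.aestronglyMeasurable,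
    integral_eq_lintegral_of_nonneg_ae
      (ae_of_all _ fun ω => mul_nonneg (hg0 _) (likelihood_pos π a h0 h1 t _).le)
      (hm.mul hΛ).aestronglyMeasurable,
    lintegral_law_altInstance π a h0 h1 t hg.ennreal_ofReal]
  simp only [ENNReal.ofReal_mul (hg0 _)]

/-! ### Query counts and the KL divergence -/

/-- The indicator that arm `a` is queried in the round played on the information `I_t`. -/
noncomputable def queried {A : ℕ} (π : Strategy A) (a : Fin A) (t : ℕ) (h : Info t) : ℝ :=
  if π.arm t h = a ∧ π.query t h = true then 1 else 0

/-- The indicator that arm `a` is played in the round played on the information `I_t`. -/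
noncomputable def played {A : ℕ} (π : Strategy A) (a : Fin A) (t : ℕ) (h : Info t) : ℝ :=
  if π.arm t h = a then 1 else 0

lemma measurable_queried {A : ℕ} (π : Strategy A) (a : Fin A) (t : ℕ) :
    Measurable (queried π a t) :=
  Measurable.ite (measurableSet_query π a t) measurable_const measurable_const

lemma measurable_played {A : ℕ} (π : Strategy A) (a : Fin A) (t : ℕ) :
    Measurable (played π a t) :=
  Measurable.ite (π.measurable_arm t (measurableSet_singleton a)) measurable_const measurable_const

lemma queried_mem {A : ℕ} (π : Strategy A) (a : Fin A) (t : ℕ) (h : Info t) :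
    queried π a t h ∈ Set.Icc (0 : ℝ) 1 := by
  unfold queried
  split_ifs <;> simp

lemma played_mem {A : ℕ} (π : Strategy A) (a : Fin A) (t : ℕ) (h : Info t) :
    played π a t h ∈ Set.Icc (0 : ℝ) 1 := by
  unfold played
  split_ifs <;> simp

lemma integrable_info {A : ℕ} (π : Strategy A) (ν : Instance A) {t : ℕ} {g : Info t → ℝ}
    (hg : Measurable g) {K : ℝ} (hK : ∀ h, |g h| ≤ K) :
    Integrable (fun ω => g (info t ω)) (law π ν) :=
  Integrable.of_bound (hg.comp (measurable_info t)).aestronglyMeasurable K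
    (ae_of_all _ fun _ => hK _)

lemma integrable_queried {A : ℕ} (π : Strategy A) (ν : Instance A) (a : Fin A) (t : ℕ) :
    Integrable (fun ω => queried π a t (info t ω)) (law π ν) :=
  integrable_info π ν (measurable_queried π a t) (K := 1) fun h =>
    abs_le.2 ⟨by linarith [(queried_mem π a t h).1], (queried_mem π a t h).2⟩

lemma integrable_played {A : ℕ} (π : Strategy A) (ν : Instance A) (a : Fin A) (t : ℕ) :
    Integrable (fun ω => played π a t (info t ω)) (law π ν) :=
  integrable_info π ν (measurable_played π a t) (K := 1) fun h =>
    abs_le.2 ⟨by linarith [(played_mem π a t h).1], (played_mem π a t h).2⟩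

/-- The Kullback-Leibler divergence `KL(fair, p)` of the fair Bernoulli law relative to the one
with mean `p`. -/
noncomputable def fairKL (p : unitInterval) : ℝ :=
  -(Real.log (2 * p) + Real.log (2 * (1 - p))) / 2

lemma integral_log_stepLikelihood {A : ℕ} (π : Strategy A) (a : Fin A) (p : unitInterval)
    (t : ℕ) (h : Info t) :
    ∫ y, Real.log (stepLikelihood π a p t (h, y)) ∂(stepKernel π (baseInstance A) t h)
      = -(queried π a t h * fairKL p) := by
  rw [stepKernel_apply]
  by_cases hq : π.arm t h = a ∧ π.query t h = true
  · rw [hq.1, hq.2, obsLaw_true]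
    simp only [stepLikelihood, if_pos hq, queried]
    have := integral_fun_fst (μ := (baseInstance A a : Measure unitInterval))
      (ν := (volume : Measure unitInterval))
      (fun y : unitInterval => Real.log (1 + (2 * (p : ℝ) - 1) * (2 * (y : ℝ) - 1)))
    rw [this]
    simp only [baseInstance, bernoulliInstance, integral_bernoulliReward, probReal_univ, one_smul,
      fairKL, Set.Icc.coe_one, Set.Icc.coe_zero]
    rw [show (1 : ℝ) + (2 * p - 1) * (2 * 1 - 1) = 2 * p by ring,
      show (1 : ℝ) + (2 * p - 1) * (2 * 0 - 1) = 2 * (1 - p) by ring]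
    ring
  · simp [stepLikelihood, if_neg hq, queried]

lemma abs_log_le_of_mem_Icc {x l : ℝ} (hl : 0 < l) (hx : x ∈ Set.Icc l 2) :
    |Real.log x| ≤ |Real.log l| + |Real.log 2| := by
  have h1 := Real.log_le_log hl hx.1
  have h2 := Real.log_le_log (hl.trans_le hx.1) hx.2
  rw [abs_le]
  constructor
  · linarith [neg_abs_le (Real.log l), abs_nonneg (Real.log 2)]
  · linarith [le_abs_self (Real.log 2), abs_nonneg (Real.log l)]

/-- The chain rule for KL: the log-likelihood is additive over rounds, and a round contributes only
if it queries `a`. -/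
lemma integral_log_likelihood {A : ℕ} (π : Strategy A) (a : Fin A) {p : unitInterval}
    (h0 : 0 < (p : ℝ)) (h1 : (p : ℝ) < 1) (t : ℕ) :
    Integrable (fun ω => Real.log (likelihood π a p t (info t ω))) (law π (baseInstance A)) ∧
    ∫ ω, Real.log (likelihood π a p t (info t ω)) ∂(law π (baseInstance A))
      = -(fairKL p * ∑ s ∈ Finset.range t,
          ∫ ω, queried π a s (info s ω) ∂(law π (baseInstance A))) := by
  induction t with
  | zero => simp [likelihood]
  | succ t ih =>
    have e : ∀ ω, Real.log (likelihood π a p (t + 1) (info (t + 1) ω))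
        = Real.log (likelihood π a p t (info t ω))
          + (fun x => Real.log (stepLikelihood π a p t x)) (info t ω, ω (t + 1)) := fun ω => by
      simp only [likelihood, Info.prev_info, Info.last_info]
      exact Real.log_mul (likelihood_pos π a h0 h1 t _).ne' (stepLikelihood_pos π a h0 h1 t _).ne'
    have hm : Measurable fun x => Real.log (stepLikelihood π a p t x) :=
      (measurable_stepLikelihood π a p t).log
    have hb : ∀ x, |Real.log (stepLikelihood π a p t x)| ≤
        |Real.log (1 - |2 * (p : ℝ) - 1|)| + |Real.log 2| := fun x =>
      abs_log_le_of_mem_Icc (one_sub_abs_pos h0 h1) (stepLikelihood_mem π a p t x)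
    have hi : Integrable (fun ω : Path =>
        (fun x => Real.log (stepLikelihood π a p t x)) (info t ω, ω (t + 1)))
        (law π (baseInstance A)) :=
      Integrable.of_bound (hm.comp ((measurable_info t).prodMk
        (measurable_pi_apply (t + 1)))).aestronglyMeasurable _ (ae_of_all _ fun _ => hb _)
    simp_rw [e]
    refine ⟨ih.1.add hi, ?_⟩
    rw [integral_add ih.1 hi, ih.2, integral_law_succ π _ t hm hb]
    simp_rw [integral_log_stepLikelihood π a p]
    rw [integral_neg, integral_mul_const, Finset.sum_range_succ]
    ring

/-! ### From KL divergence to a difference of expectations -/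

/-- A pointwise substitute for Pinsker's inequality. For `x ≤ 1`, `1 - x ≤ 2 * (1 - √x)`, AM-GM with
weight `η` applies, and `(1 - √x) ^ 2 ≤ x - 1 - log x` because `log x ≤ 2 * (√x - 1)`. -/
lemma one_sub_le_log_bound {x η : ℝ} (hx : 0 < x) (hη : 0 < η) :
    1 - x ≤ η + (x - 1 - Real.log x) / η := by
  have hlog : Real.log x ≤ 2 * (Real.sqrt x - 1) := by
    have := Real.log_le_sub_one_of_pos (Real.sqrt_pos.2 hx)
    rw [Real.log_sqrt hx.le] at this
    linarith
  have hs := Real.sq_sqrt hx.le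
  have hs0 := Real.sqrt_nonneg x
  rcases le_total 1 x with h | h
  · have := Real.log_le_sub_one_of_pos hx
    have : 0 ≤ (x - 1 - Real.log x) / η := div_nonneg (by linarith) hη.le
    linarith
  · have hs1 : Real.sqrt x ≤ 1 := Real.sqrt_le_one.2 h
    have h2 : (1 - Real.sqrt x) ^ 2 / η ≤ (x - 1 - Real.log x) / η := by
      gcongr
      nlinarith
    have h3 : 2 * (1 - Real.sqrt x) ≤ η + (1 - Real.sqrt x) ^ 2 / η := by
      rw [← sub_nonneg]
      have : η + (1 - Real.sqrt x) ^ 2 / η - 2 * (1 - Real.sqrt x)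
          = (η - (1 - Real.sqrt x)) ^ 2 / η := by
        field_simp
        ring
      rw [this]
      positivity
    nlinarith

/-- The difference is the integral of `g * (1 - Λ)` with `Λ` the likelihood ratio. The pointwise
bound at `x = Λ` is integrated; since `Λ` has mean `1`, only `-log Λ`, that is the KL divergence,
survives. -/
lemma integral_baseInstance_sub_altInstance_le {A : ℕ} (π : Strategy A) (a : Fin A)
    {p : unitInterval} (h0 : 0 < (p : ℝ)) (h1 : (p : ℝ) < 1) (t : ℕ) {g : Info t → ℝ}
    (hg : Measurable g) (hg1 : ∀ h, g h ∈ Set.Icc (0 : ℝ) 1) {η : ℝ} (hη : 0 < η) :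
    ∫ ω, g (info t ω) ∂(law π (baseInstance A))
        - ∫ ω, g (info t ω) ∂(law π (altInstance a p))
      ≤ η + fairKL p * (∑ s ∈ Finset.range t,
          ∫ ω, queried π a s (info s ω) ∂(law π (baseInstance A))) / η := by
  set P := law π (baseInstance A)
  have hΛm := measurable_likelihood π a p t
  have hΛb : ∀ h, |likelihood π a p t h| ≤ 2 ^ t := fun h => by
    rw [abs_of_pos (likelihood_pos π a h0 h1 t h)]
    exact likelihood_le π a h0 h1 t h
  have hΛ : Integrable (fun ω => likelihood π a p t (info t ω)) P := integrable_info π _ hΛm hΛb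
  have hgb : ∀ h, |g h| ≤ 1 := fun h => abs_le.2 ⟨by linarith [(hg1 h).1], (hg1 h).2⟩
  have hgi : Integrable (fun ω => g (info t ω)) P := integrable_info π _ hg hgb
  have hgΛ : Integrable (fun ω => g (info t ω) * likelihood π a p t (info t ω)) P :=
    integrable_info π _ (g := fun h => g h * likelihood π a p t h) (hg.mul hΛm)
      (K := 1 * 2 ^ t) fun h => by
      rw [abs_mul]
      exact mul_le_mul (hgb h) (hΛb h) (abs_nonneg _) zero_le_one
  obtain ⟨hlog, hlogeq⟩ := integral_log_likelihood π a h0 h1 t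
  have hΛ1 : ∫ ω, likelihood π a p t (info t ω) ∂P = 1 := by
    have := integral_law_altInstance π a h0 h1 t (g := fun _ => 1) measurable_const
      fun _ => zero_le_one
    simpa using this.symm
  rw [integral_law_altInstance π a h0 h1 t hg fun h => (hg1 h).1, ← integral_sub hgi hgΛ]
  have hΛ1i : Integrable (fun ω => likelihood π a p t (info t ω) - 1) P :=
    hΛ.sub (integrable_const 1)
  have hgap : Integrable (fun ω => likelihood π a p t (info t ω) - 1
      - Real.log (likelihood π a p t (info t ω))) P := hΛ1i.sub hlog
  have hub : Integrable (fun ω => η + (likelihood π a p t (info t ω) - 1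
      - Real.log (likelihood π a p t (info t ω))) / η) P :=
    (integrable_const η).add (hgap.div_const η)
  refine (integral_mono (hgi.sub hgΛ) hub fun ω => ?_).trans_eq ?_
  · have hpos := likelihood_pos π a h0 h1 t (info t ω)
    have hl := one_sub_le_log_bound hpos hη
    -- Nonnegativity of the upper bound allows multiplying by `g ∈ [0,1]`, even where `1 - Λ` is
    -- negative.
    have h2 : 0 ≤ η + (likelihood π a p t (info t ω) - 1
        - Real.log (likelihood π a p t (info t ω))) / η := by
      have := Real.log_le_sub_one_of_pos hpos
      have : 0 ≤ (likelihood π a p t (info t ω) - 1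
        - Real.log (likelihood π a p t (info t ω))) / η := div_nonneg (by linarith) hη.le
      linarith
    have hgm := hg1 (info t ω)
    simp only [Pi.sub_apply]
    nlinarith [hgm.1, hgm.2]
  · rw [integral_add (integrable_const η) (hgap.div_const η), integral_div, integral_sub hΛ1i hlog,
      integral_sub hΛ (integrable_const 1), hΛ1, hlogeq]
    simp [P]

/-! ### Regret caused by a rarely queried arm -/

lemma meanReward_le_iSup {A : ℕ} (ν : Instance A) (b : Fin A) :
    meanReward ν b ≤ ⨆ a, meanReward ν a :=
  le_ciSup (Set.finite_range (meanReward ν)).bddAbove b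

lemma gap_nonneg {A : ℕ} (π : Strategy A) (ν : Instance A) (s : ℕ) (h : Info s) :
    0 ≤ (⨆ a, meanReward ν a) - meanReward ν (π.arm s h) :=
  sub_nonneg.2 (meanReward_le_iSup ν _)

lemma integrable_gap {A : ℕ} (π : Strategy A) (ν : Instance A) (s : ℕ) :
    Integrable (fun ω => (⨆ a, meanReward ν a) - meanReward ν (π.arm s (info s ω)))
      (law π ν) := by
  refine integrable_info π ν (g := fun h => (⨆ a, meanReward ν a) - meanReward ν (π.arm s h))
    (measurable_const.sub
      ((Measurable.of_discrete (f := meanReward ν)).comp (π.measurable_arm s)))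
    (K := ⨆ b, ((⨆ a, meanReward ν a) - meanReward ν b)) fun h => ?_
  rw [abs_of_nonneg (gap_nonneg π ν s h)]
  exact le_ciSup (f := fun b => (⨆ a, meanReward ν a) - meanReward ν b)
    (Set.finite_range _).bddAbove (π.arm s h)

lemma mul_sum_le_integral_regret {A : ℕ} (π : Strategy A) (ν : Instance A) {t T : ℕ}
    (htT : t ≤ T) (δ : ℝ) {X : (s : ℕ) → Info s → ℝ}
    (hXi : ∀ s, Integrable (fun ω => X s (info s ω)) (law π ν))
    (hX : ∀ s h, δ * X s h ≤ (⨆ a, meanReward ν a) - meanReward ν (π.arm s h)) :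
    δ * ∑ s ∈ Finset.range t, ∫ ω, X s (info s ω) ∂(law π ν)
      ≤ ∫ ω, regret π ν T ω ∂(law π ν) := by
  unfold regret
  rw [integral_finsetSum _ fun s _ => integrable_gap π ν s, Finset.mul_sum]
  refine le_trans (Finset.sum_le_sum fun s _ => ?_)
    (Finset.sum_le_sum_of_subset_of_nonneg (Finset.range_mono htT) fun s _ _ =>
      integral_nonneg fun ω => gap_nonneg π ν s _)
  rw [← integral_const_mul]
  exact integral_mono ((hXi s).const_mul δ) (integrable_gap π ν s) fun ω => hX s _

lemma meanReward_altInstance_self {A : ℕ} (a : Fin A) (p : unitInterval) :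
    meanReward (altInstance a p) a = p := by
  simp [altInstance]

lemma meanReward_altInstance_of_ne {A : ℕ} {a b : Fin A} (h : b ≠ a) (p : unitInterval) :
    meanReward (altInstance a p) b = 1 / 2 := by
  simp [altInstance, Function.update_of_ne h]

/-- The divergence is `-log (4 * p * (1 - p)) / 2`, which depends only on `(2 * p - 1) ^ 2`; this
covers both shifts `p = 1 / 2 ± ε / 10`. -/
lemma fairKL_le {p : unitInterval} {ε : ℝ} (hε : 0 ≤ ε) (hε1 : ε ≤ 1)
    (hp : (2 * (p : ℝ) - 1) ^ 2 = (ε / 5) ^ 2) (h0 : 0 < (p : ℝ)) (h1 : (p : ℝ) < 1) :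
    fairKL p ≤ ε ^ 2 / 48 := by
  have hε2 : ε ^ 2 ≤ 1 := pow_le_one₀ hε hε1
  have hprod : 2 * (p : ℝ) * (2 * (1 - p)) = 1 - ε ^ 2 / 25 := by nlinarith
  have hx : 0 < 1 - ε ^ 2 / 25 := by linarith
  have hlog := Real.one_sub_inv_le_log_of_pos hx
  have hinv : (1 - ε ^ 2 / 25)⁻¹ ≤ 1 + ε ^ 2 / 24 := by
    rw [inv_le_iff_one_le_mul₀ hx]
    nlinarith [sq_nonneg ε]
  rw [fairKL, ← Real.log_mul (by linarith) (by linarith), hprod]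
  linarith

lemma sum_integral_altInstance_ge {A : ℕ} (π : Strategy A) (a : Fin A) {p : unitInterval}
    {ε : ℝ} (hε : 0 ≤ ε) (hε1 : ε ≤ 1) (hp : (2 * (p : ℝ) - 1) ^ 2 = (ε / 5) ^ 2)
    (h0 : 0 < (p : ℝ)) (h1 : (p : ℝ) < 1) (t : ℕ)
    (hn : (∑ s ∈ Finset.range t, ∫ ω, queried π a s (info s ω) ∂(law π (baseInstance A)))
      * ε ^ 2 ≤ 1)
    {X : (s : ℕ) → Info s → ℝ} (hXm : ∀ s, Measurable (X s))
    (hX : ∀ s h, X s h ∈ Set.Icc (0 : ℝ) 1) :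
    ∑ s ∈ Finset.range t, ∫ ω, X s (info s ω) ∂(law π (baseInstance A)) - 3 / 10 * t
      ≤ ∑ s ∈ Finset.range t, ∫ ω, X s (info s ω) ∂(law π (altInstance a p)) := by
  have hq : ∀ s, 0 ≤ ∫ ω, queried π a s (info s ω) ∂(law π (baseInstance A)) := fun s =>
    integral_nonneg fun ω => (queried_mem π a s _).1
  have key : ∀ s ∈ Finset.range t, ∫ ω, X s (info s ω) ∂(law π (baseInstance A)) - 3 / 10
      ≤ ∫ ω, X s (info s ω) ∂(law π (altInstance a p)) := fun s hs => by
    -- With KL at most `1 / 48`, this `η` gives `3 / 20 + (1 / 48) / (3 / 20) < 3 / 10`.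
    have h := integral_baseInstance_sub_altInstance_le π a h0 h1 s (hXm s) (hX s)
      (η := 3 / 20) (by norm_num)
    have hs' : ∑ r ∈ Finset.range s, ∫ ω, queried π a r (info r ω) ∂(law π (baseInstance A))
        ≤ ∑ r ∈ Finset.range t, ∫ ω, queried π a r (info r ω) ∂(law π (baseInstance A)) :=
      Finset.sum_le_sum_of_subset_of_nonneg (Finset.range_mono (Finset.mem_range.1 hs).le)
        fun r _ _ => hq r
    have hs0 := Finset.sum_nonneg fun r (_ : r ∈ Finset.range s) => hq r
    have hD := (mul_le_mul_of_nonneg_right (fairKL_le hε hε1 hp h0 h1) hs0).trans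
      (mul_le_mul_of_nonneg_left hs' (by positivity))
    linarith
  have := Finset.sum_le_sum key
  rw [Finset.sum_sub_distrib] at this
  simp only [Finset.sum_const, Finset.card_range, nsmul_eq_mul] at this
  linarith

/-- At least `t / 2 - 3 * t / 10 = t / 5` expected wrong choices remain after the shift, each
costing at least `ε / 10`. -/
lemma exists_instance_of_few_queries {A : ℕ} (hA : 2 ≤ A) (π : Strategy A) (a : Fin A)
    {ε : ℝ} (hε : 0 ≤ ε) (hε1 : ε ≤ 1) {t T : ℕ} (htT : t ≤ T)
    (hn : (∑ s ∈ Finset.range t, ∫ ω, queried π a s (info s ω) ∂(law π (baseInstance A)))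
      * ε ^ 2 ≤ 1) :
    ∃ ν : Instance A, t * ε / 50 ≤ ∫ ω, regret π ν T ω ∂(law π ν) := by
  have : Nontrivial (Fin A) := Fin.nontrivial_iff_two_le.2 hA
  rcases le_total (∑ s ∈ Finset.range t, ∫ ω, played π a s (info s ω) ∂(law π (baseInstance A)))
    (t / 2 : ℝ) with hpl | hpl
  · let p : unitInterval := ⟨1 / 2 + ε / 10, by positivity, by linarith⟩
    have hp : (p : ℝ) = 1 / 2 + ε / 10 := rfl
    have hsum := sum_integral_altInstance_ge π a hε hε1 (p := p) (by rw [hp]; ring)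
      (by rw [hp]; positivity) (by rw [hp]; linarith) t hn
      (X := fun s h => 1 - played π a s h) (fun s => measurable_const.sub (measurable_played π a s))
      (fun s h => ⟨by linarith [(played_mem π a s h).2], by linarith [(played_mem π a s h).1]⟩)
    have hreg := mul_sum_le_integral_regret π (altInstance a p) htT (ε / 10)
      (X := fun s h => 1 - played π a s h)
      (fun s => (integrable_const 1).sub (integrable_played π _ a s)) fun s h => by
        by_cases ha : π.arm s h = a
        · simpa [played, ha] using meanReward_le_iSup (altInstance a p) a
        · have := meanReward_le_iSup (altInstance a p) a
          rw [meanReward_altInstance_self, hp] at this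
          rw [meanReward_altInstance_of_ne ha]
          simp only [played, if_neg ha]
          linarith
    refine ⟨altInstance a p, le_trans ?_ hreg⟩
    simp only [integral_sub (integrable_const (1 : ℝ)) (integrable_played π (baseInstance A) a _),
      integral_const, probReal_univ, smul_eq_mul, mul_one, Finset.sum_sub_distrib,
      Finset.sum_const, Finset.card_range, nsmul_eq_mul] at hsum
    nlinarith
  · let p : unitInterval := ⟨1 / 2 - ε / 10, by linarith, by linarith⟩
    have hp : (p : ℝ) = 1 / 2 - ε / 10 := rfl
    have hsum := sum_integral_altInstance_ge π a hε hε1 (p := p) (by rw [hp]; ring)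
      (by rw [hp]; linarith) (by rw [hp]; linarith) t hn
      (X := played π a) (measurable_played π a) (played_mem π a)
    have hreg := mul_sum_le_integral_regret π (altInstance a p) htT (ε / 10)
      (X := played π a) (integrable_played π _ a) fun s h => by
        by_cases ha : π.arm s h = a
        -- Lowering the mean of `a` creates a gap only because another arm keeps mean `1 / 2`.
        · obtain ⟨b, hb⟩ := exists_ne a
          have := meanReward_le_iSup (altInstance a p) b
          rw [meanReward_altInstance_of_ne hb] at this
          rw [ha, meanReward_altInstance_self, hp]
          simp only [played, if_pos ha]
          linarith
        · simpa [played, ha] using meanReward_le_iSup (altInstance a p) (π.arm s h)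
    refine ⟨altInstance a p, le_trans ?_ hreg⟩
    nlinarith

/-! ### The budget yields a rarely queried arm -/

lemma integral_queryCost {A : ℕ} (π : Strategy A) (ν : Instance A) (c : Fin A → ℝ) (t : ℕ) :
    ∫ ω, queryCost π c t ω ∂(law π ν)
      = ∑ a, c a * ∑ s ∈ Finset.range t, ∫ ω, queried π a s (info s ω) ∂(law π ν) := by
  have h : ∀ ω, queryCost π c t ω
      = ∑ s ∈ Finset.range t, ∑ a, c a * queried π a s (info s ω) := fun ω => by
    refine Finset.sum_congr rfl fun s _ => ?_
    by_cases hq : π.query s (info s ω) = true <;> simp [queried, hq]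
  simp_rw [h]
  rw [integral_finsetSum _ fun s _ => integrable_finsetSum _ fun a _ =>
    (integrable_queried π ν a s).const_mul (c a)]
  simp_rw [Finset.mul_sum]
  rw [Finset.sum_comm]
  refine Finset.sum_congr rfl fun s _ => ?_
  rw [integral_finsetSum _ fun a _ => (integrable_queried π ν a s).const_mul (c a)]
  simp_rw [integral_const_mul]

lemma exists_instance_of_budget {A : ℕ} (hA : 2 ≤ A) (π : Strategy A) {c : Fin A → ℝ}
    (hc : ∀ a, 0 ≤ c a) {b : ℝ} (hb : 0 < b) {t T : ℕ} (htT : t ≤ T)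
    (hbudget : ∫ ω, queryCost π c t ω ∂(law π (baseInstance A)) ≤ b) :
    ∃ ν : Instance A, t * min (Real.sqrt ((∑ a, c a) / b)) 1 / 50
      ≤ ∫ ω, regret π ν T ω ∂(law π ν) := by
  have hC0 : 0 ≤ ∑ a, c a := Finset.sum_nonneg fun a _ => hc a
  set ε := min (Real.sqrt ((∑ a, c a) / b)) 1 with hεdef
  have hε : 0 ≤ ε := le_min (Real.sqrt_nonneg _) zero_le_one
  have hε2 : ε ^ 2 * b ≤ ∑ a, c a := by
    have h1 : ε ^ 2 ≤ Real.sqrt ((∑ a, c a) / b) ^ 2 := pow_le_pow_left₀ hε (min_le_left _ _) 2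
    rw [Real.sq_sqrt (by positivity)] at h1
    exact (le_div_iff₀ hb).1 h1
  suffices ∃ a : Fin A, (∑ s ∈ Finset.range t,
      ∫ ω, queried π a s (info s ω) ∂(law π (baseInstance A))) * ε ^ 2 ≤ 1 by
    obtain ⟨a, ha⟩ := this
    exact exists_instance_of_few_queries hA π a hε (min_le_right _ _) htT ha
  by_contra! hlt
  rw [integral_queryCost] at hbudget
  have hle := mul_le_mul_of_nonneg_left hbudget (sq_nonneg ε)
  rw [Finset.mul_sum] at hle
  -- If all costs vanish the weighted average says nothing, but then `ε = 0` and any arm will do.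
  rcases hC0.eq_or_lt with hC | hC
  · have hε0 : ε = 0 := by
      rw [hεdef, ← hC]
      simp
    have := hlt ⟨0, by omega⟩
    rw [hε0] at this
    norm_num at this
  · obtain ⟨i, hi, hci⟩ := Finset.exists_ne_zero_of_sum_ne_zero hC.ne'
    have hlt' : ∑ a, c a < ∑ a, ε ^ 2 * (c a * ∑ s ∈ Finset.range t,
        ∫ ω, queried π a s (info s ω) ∂(law π (baseInstance A))) := by
      refine Finset.sum_lt_sum (fun a _ => ?_) ⟨i, hi, ?_⟩
      · nlinarith [hlt a, hc a]
      · nlinarith [hlt i, (hc i).lt_of_ne' hci]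
    linarith

end BudgetedBandit

/-! ### Summation over rounds and conclusion -/

theorem Finset.sum_le_mul_one_add_log {T : ℕ} {f : ℕ → ℝ} {M : ℝ} (hM : 0 ≤ M)
    (hf : ∀ t ∈ Finset.Icc 1 T, t * f t ≤ M) :
    ∑ t ∈ Finset.Icc 1 T, f t ≤ M * (1 + Real.log T) := by
  have hH : ∑ t ∈ Finset.Icc 1 T, ((t : ℝ))⁻¹ ≤ 1 + Real.log T := by
    have := harmonic_le_one_add_log T
    rw [harmonic_eq_sum_Icc] at this
    push_cast at this
    exact this
  refine le_trans ?_ (mul_le_mul_of_nonneg_left hH hM)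
  rw [Finset.mul_sum]
  refine Finset.sum_le_sum fun t ht => ?_
  have ht0 : (0 : ℝ) < t := by exact_mod_cast (Finset.mem_Icc.1 ht).1
  rw [← div_eq_mul_inv, le_div_iff₀ ht0, mul_comm]
  exact hf t ht

theorem mainTheorem4 (A T : ℕ) (hA : 2 ≤ A) (hT : 1 ≤ T)
    (c : Fin A → ℝ) (hc : ∀ a, 0 ≤ c a)
    (B : ℕ → ℝ) (hBpos : ∀ t ∈ Set.Icc 1 T, 0 < B t) (hBmono : MonotoneOn B (Set.Icc 1 T))
    (π : BudgetedBandit.Strategy A)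
    (hπ : ∀ ν : BudgetedBandit.Instance A, ∀ t ∈ Set.Icc 1 T,
      ∫ ω, BudgetedBandit.queryCost π c t ω ∂(BudgetedBandit.law π ν) ≤ B t) :
    ∃ ν : BudgetedBandit.Instance A,
      1 / (140 * (1 + Real.log (T : ℝ))) *
          ∑ t ∈ Finset.Icc 1 T,
            min (Real.sqrt ((∑ a, c a) / (B t * (1 + Real.log (A : ℝ))))) 1
        ≤ ∫ ω, BudgetedBandit.regret π ν T ω ∂(BudgetedBandit.law π ν) := by
  have hC0 : 0 ≤ ∑ a, c a := Finset.sum_nonneg fun a _ => hc a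
  have hlogA : 0 ≤ Real.log (A : ℝ) := Real.log_natCast_nonneg A
  have hlogT : 0 ≤ Real.log (T : ℝ) := Real.log_natCast_nonneg T
  obtain ⟨t, ht, hmax⟩ := Finset.exists_max_image (Finset.Icc 1 T)
    (fun t : ℕ => (t : ℝ) * min (Real.sqrt ((∑ a, c a) / B t)) 1)
    ⟨1, Finset.mem_Icc.2 ⟨le_rfl, hT⟩⟩
  have ht' := Finset.mem_Icc.1 ht
  obtain ⟨ν, hν⟩ := BudgetedBandit.exists_instance_of_budget hA π hc (hBpos t ht') ht'.2
    (hπ (BudgetedBandit.baseInstance A) t ht')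
  refine ⟨ν, le_trans ?_ hν⟩
  set M := (t : ℝ) * min (Real.sqrt ((∑ a, c a) / B t)) 1
  have hM : 0 ≤ M := mul_nonneg t.cast_nonneg (le_min (Real.sqrt_nonneg _) zero_le_one)
  have hle : ∑ t ∈ Finset.Icc 1 T,
      min (Real.sqrt ((∑ a, c a) / (B t * (1 + Real.log (A : ℝ))))) 1 ≤ M * (1 + Real.log T) := by
    refine Finset.sum_le_mul_one_add_log hM fun s hs => le_trans ?_ (hmax s hs)
    have hB := hBpos s (Finset.mem_Icc.1 hs)
    gcongr
    exact le_mul_of_one_le_right hB.le (by linarith)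
  -- The constant `50` obtained is better than the required `140`.
  rw [one_div, inv_mul_le_iff₀ (by positivity)]
  nlinarith [mul_nonneg hM hlogT]
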